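/- Let $\mathcal H$ be a complex Hilbert space and let $x$ be a compact linear operator on $\mathcal H$. Let $\mu_1(x)\ge\mu_2(x)\ge\dots\ge 0$ be the characteristic sequence of $x$, i.e. the eigenvalues of $|x|=\sqrt{x^*x}$ in decreasing order, each non-zero eigenvalue repeated according to its multiplicity (and the sequence continued by $0$ if there are only finitely many of them). Suppose that $\mu_n(x)=O(1/n)$ as $n\to\infty$, so that $$\zeta_x(z)=\sum_{n\ge 1}\mu_n(x)^z$$ converges absolutely for $\operatorname{Re} z>1$ (with the convention $0^z=0$). Let $L\in\mathbb C$, and suppose that $\zeta_x$ admits an extension $F$ to the closed half-plane $\operatorname{Re} z\ge 1$ that is continuous there except, at worst, for a simple pole with residue $L$ at $z=1$; that is, $F$ coincides with $\zeta_x$ on $\operatorname{Re} z>1$, $F$ is continuous on $\{z:\operatorname{Re} z\ge 1\}\setminus\{1\}$, and $F(z)-\dfrac{L}{z-1}$ has a finite limit as $z\to 1$ within $\{z:\operatorname{Re} z\ge 1\}\setminus\{1\}$ (with $L=0$ if there is no pole). Then $\mu_n(x)\sim L\cdot n^{-1}$, that is, $$\lim_{n\to\infty}\frac{\mu_n(x)}{1/n}=L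 .$$ -/

import Mathlib

open Filter Topology Asymptotics

/-- For a bounded operator `x` on a complex Hilbert space and a real number `t`, the span of all
eigenspaces of `|x| = √(x* x)` that belong to eigenvalues `> t`. Eigenspaces of distinct
eigenvalues are independent, so its dimension is the number of eigenvalues `> t` of `|x|`, counted
with multiplicity. -/
noncomputable def spectralSubspaceAbove {H : Type*} [NormedAddCommGroup H] [InnerProductSpace ℂ H]
    [CompleteSpace H] (x : H →L[ℂ] H) (t : ℝ) : Submodule ℂ H :=
  ⨆ (s : ℝ) (_ : t < s), Module.End.eigenspace (CFC.abs x : H →L[ℂ] H).toLinearMap (s : ℂ)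

/-- The characteristic sequence `μ₁(x) ≥ μ₂(x) ≥ …` of a compact operator `x`: the eigenvalues of
`|x|` in decreasing order, non-zero ones repeated according to their multiplicity (and continued
by `0` if there are only finitely many). The `n`-th term of that list, `n ≥ 1`, is the least
`t ≥ 0` such that fewer than `n` eigenvalues, counted with multiplicity, exceed `t`.
The index starts at `1`; the value at `0` is not used. -/
noncomputable def charSeq {H : Type*} [NormedAddCommGroup H] [InnerProductSpace ℂ H]
    [CompleteSpace H] (x : H →L[ℂ] H) (n : ℕ) : ℝ :=
  sInf {t : ℝ | 0 ≤ t ∧ Module.rank ℂ (spectralSubspaceAbove x t) < (n : Cardinal)}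

/-- `ζ_x(z) = ∑_{n ≥ 1} μ_n(x)^z`, used for `Re z > 1` (with `0 ^ z = 0` there). -/
noncomputable def zetaOp {H : Type*} [NormedAddCommGroup H] [InnerProductSpace ℂ H]
    [CompleteSpace H] (x : H →L[ℂ] H) (z : ℂ) : ℂ :=
  ∑' n : ℕ, (charSeq x (n + 1) : ℂ) ^ z

/-- The function `f`, given on `Re z > 1`, has an extension `F` to the closed half-plane
`Re z ≥ 1` that is continuous there except, at worst, for a simple pole with residue `L` at
`z = 1`: `F` is continuous at the other points, and `F(z) - L / (z - 1)` has a finite limit as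
`z → 1` in the closed half-plane (for `L = 0` there is no pole). -/
def ExtendsUpToSimplePole (f : ℂ → ℂ) (L : ℂ) : Prop :=
  ∃ F : ℂ → ℂ, (∀ z : ℂ, 1 < z.re → F z = f z) ∧
    ContinuousOn F ({z : ℂ | 1 ≤ z.re} \ {1}) ∧
    ∃ c : ℂ, Tendsto (fun z => F z - L / (z - 1)) (𝓝[{z : ℂ | 1 ≤ z.re} \ {1}] 1) (𝓝 c)

/-! This is a Wiener-Ikehara argument. Let N(u) count the n with μ_n ≥ exp (-u) and put B(u) = exp
(-u) N(u), which is bounded because μ_n = O(1/n). Integrating termwise, B has Laplace transform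
ζ(1+s)/(1+s) = L/s + G(s) with G continuous up to Re s = 0 (`integral_exp_mul_countAbove`).
Subtracting the step function L·1_{u>0} removes the pole. Fubini, the limit Re s → 0 and the
Riemann-Lebesgue lemma then show that averages of the difference against Fourier transforms of
compactly supported functions vanish at infinity (`tendsto_integral_mul_fourier_of_laplace`). With a
nonnegative kernel, rescaled arbitrarily finely, and the monotonicity of exp u · B(u), convergence
of averages becomes B → L (`tendsto_of_tendsto_average`). Inverting the counting function gives n
μ_n → L. -/

/-! ### Fourier kernel and Tauberian criterion -/

open MeasureTheory FourierTransform in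
/-- There is a continuous compactly supported function whose Fourier transform is nonnegative,
integrable and nonzero. -/
theorem exists_hasCompactSupport_fourier_nonneg :
    ∃ (g : ℝ → ℂ) (K : ℝ → ℝ), Continuous g ∧ HasCompactSupport g ∧ (∀ w, 𝓕 g w = K w) ∧
      (∀ w, 0 ≤ K w) ∧ Integrable K ∧ 0 < ∫ w, K w := by
  let φ : ContDiffBump (0 : ℝ) := ⟨1, 2, one_pos, one_lt_two⟩
  let ψ : ℝ → ℂ := fun v => (φ v : ℂ)
  have hψsmooth : ContDiff ℝ ((⊤ : ℕ∞) : WithTop ℕ∞) ψ := Complex.ofRealCLM.contDiff.comp φ.contDiff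
  have hψsupp : HasCompactSupport ψ := φ.hasCompactSupport.comp_left Complex.ofReal_zero
  have hψc : Continuous ψ := hψsmooth.continuous
  have hψi : Integrable ψ := hψc.integrable_of_hasCompactSupport hψsupp
  let S : SchwartzMap ℝ ℂ := hψsupp.toSchwartzMap hψsmooth
  have hS : ∀ w, (𝓕 S) w = 𝓕 ψ w := fun w => rfl
  -- The bump is real and even, so its transform is real; the transform of ψ ∗ ψ is then the square
  -- of a real function.
  have hreal : ∀ w, ((𝓕 ψ w).re : ℂ) = 𝓕 ψ w := by
    intro w
    rw [← Complex.conj_eq_iff_re, Real.fourier_real_eq, ← integral_conj,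
      ← integral_neg_eq_self]
    refine integral_congr_ae (Eventually.of_forall fun v => ?_)
    simp only [ψ, Circle.smul_def, smul_eq_mul, map_mul, Complex.conj_ofReal, φ.neg]
    congr 1
    rw [← Circle.coe_inv_eq_conj, ← AddChar.map_neg_eq_inv]
    simp
  refine ⟨convolution ψ ψ (ContinuousLinearMap.mul ℂ ℂ) volume,
    fun w => (𝓕 ψ w).re ^ 2, ?_, ?_, ?_, fun w => sq_nonneg _, ?_, ?_⟩
  · exact hψsupp.continuous_convolution_right _ hψi.locallyIntegrable hψc
  · exact hψsupp.convolution _ hψsupp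
  · intro w
    rw [Real.fourier_mul_convolution_eq hψi hψi, Complex.ofReal_pow, hreal, sq]
  all_goals
    have hmem : MemLp (fun w => (𝓕 ψ w).re) 2 volume := ((𝓕 S).memLp 2 volume).re
    have hint := hmem.integrable_sq
  · exact hint
  · refine integral_pos_of_integrable_nonneg_nonzero (x := 0) ?_ hint (fun w => sq_nonneg _) ?_
    · exact (Complex.continuous_re.comp (𝓕 S).continuous).pow 2
    · have h0 : 𝓕 ψ 0 = ((∫ v, φ v : ℝ) : ℂ) := by
        simp [Real.fourier_real_eq, ψ, integral_complex_ofReal]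
      rw [h0, Complex.ofReal_re]
      exact pow_ne_zero 2 φ.integral_pos.ne'

theorem measurable_of_monotone_exp_mul {B : ℝ → ℝ} (hB : Monotone fun u => Real.exp u * B u) :
    Measurable B := by
  have : B = fun u => Real.exp (-u) * (Real.exp u * B u) := by
    funext u; rw [← mul_assoc, ← Real.exp_add]; simp
  rw [this]
  exact (Real.measurable_exp.comp measurable_neg).mul hB.measurable

/-- A Tauberian criterion: if all the rescaled averages of a slowly decreasing bounded function
converge, so does the function. -/
theorem tendsto_of_tendsto_average {B K : ℝ → ℝ} {M l : ℝ} (hB0 : ∀ u, 0 ≤ B u)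
    (hBM : ∀ u, B u ≤ M) (hmono : Monotone fun u => Real.exp u * B u) (hK0 : ∀ w, 0 ≤ K w)
    (hK : MeasureTheory.Integrable K) (hKpos : 0 < ∫ w, K w)
    (h : ∀ δ > 0, Tendsto (fun x => ∫ w, B (x + δ * w) * K w) atTop (𝓝 (l * ∫ w, K w))) :
    Tendsto B atTop (𝓝 l) := by
  set I := ∫ w, K w with hI
  have hBmeas := measurable_of_monotone_exp_mul hmono
  -- Slow decrease: moving right by d costs at most a factor exp (-d).
  have hshift : ∀ u v, u ≤ v → Real.exp (u - v) * B u ≤ B v := by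
    intro u v huv
    have := hmono huv
    simp only at this
    rw [Real.exp_sub, div_mul_eq_mul_div, div_le_iff₀ (Real.exp_pos v)]
    linarith
  have hint : ∀ x δ : ℝ, MeasureTheory.Integrable fun w => B (x + δ * w) * K w := by
    intro x δ
    refine hK.bdd_mul (c := M) (hBmeas.comp (by fun_prop)).aestronglyMeasurable
      (Eventually.of_forall fun w => ?_)
    rw [Real.norm_of_nonneg (hB0 _)]
    exact hBM _
  let J : ℝ → ℝ := fun R => ∫ w in Set.Ioc (-R) R, K w
  have hJ : Tendsto J atTop (𝓝 I) := by
    have h1 := MeasureTheory.intervalIntegral_tendsto_integral hK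
      (tendsto_neg_atTop_atBot) tendsto_id
    refine h1.congr' ?_
    filter_upwards [eventually_ge_atTop 0] with R hR
    exact intervalIntegral.integral_of_le (by simp only [id]; linarith)
  have hJI : ∀ R, J R ≤ I := fun R =>
    MeasureTheory.setIntegral_le_integral hK (Eventually.of_forall hK0)
  have hJ0 : ∀ R, 0 ≤ J R := fun R => MeasureTheory.integral_nonneg hK0
  -- The centre is moved right by δR, so that for w in (-R, R] the argument lies within 2δR to the
  -- right of x.
  have hlow : ∀ (δ R x : ℝ), 0 < δ → 0 < R → B x * (Real.exp (-(2 * δ * R)) * J R) ≤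
      ∫ w, B (x + δ * R + δ * w) * K w := by
    intro δ R x hδ hR
    calc B x * (Real.exp (-(2 * δ * R)) * J R)
        = ∫ w in Set.Ioc (-R) R, B x * Real.exp (-(2 * δ * R)) * K w := by
          rw [MeasureTheory.integral_const_mul]; simp only [J]; ring
      _ ≤ ∫ w in Set.Ioc (-R) R, B (x + δ * R + δ * w) * K w := by
          refine MeasureTheory.setIntegral_mono_on (hK.const_mul _).integrableOn
            (hint _ _).integrableOn measurableSet_Ioc fun w hw => ?_
          refine mul_le_mul_of_nonneg_right ?_ (hK0 w)
          have h1 := mul_le_mul_of_nonneg_left hw.1.le hδ.le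
          have h2 := mul_le_mul_of_nonneg_left hw.2 hδ.le
          refine le_trans ?_ (hshift x (x + δ * R + δ * w) (by linarith))
          rw [mul_comm]
          exact mul_le_mul_of_nonneg_right (Real.exp_le_exp.2 (by linarith)) (hB0 x)
      _ ≤ _ := MeasureTheory.setIntegral_le_integral (hint _ _)
          (Eventually.of_forall fun w => mul_nonneg (hB0 _) (hK0 w))
  -- Mirror image, with the window to the left of x. The tail |w| > R no longer has a favourable
  -- sign and is paid for with B ≤ M.
  have hupp : ∀ (δ R x : ℝ), 0 < δ → 0 < R → (∫ w, B (x + -(δ * R) + δ * w) * K w) ≤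
      Real.exp (2 * δ * R) * I * B x + M * (I - J R) := by
    intro δ R x hδ hR
    rw [← MeasureTheory.integral_add_compl (measurableSet_Ioc (a := -R) (b := R)) (hint _ _)]
    refine add_le_add ?_ ?_
    · calc _ ≤ ∫ w in Set.Ioc (-R) R, Real.exp (2 * δ * R) * B x * K w := by
            refine MeasureTheory.setIntegral_mono_on (hint _ _).integrableOn
              (hK.const_mul _).integrableOn measurableSet_Ioc fun w hw => ?_
            refine mul_le_mul_of_nonneg_right ?_ (hK0 w)
            have h1 := mul_le_mul_of_nonneg_left hw.1.le hδ.le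
            have h2 := mul_le_mul_of_nonneg_left hw.2 hδ.le
            have h3 := hshift (x + -(δ * R) + δ * w) x (by linarith)
            rw [Real.exp_sub, div_mul_eq_mul_div, div_le_iff₀ (Real.exp_pos _)] at h3
            have h4 : B (x + -(δ * R) + δ * w) ≤
                B x * Real.exp (x - (x + -(δ * R) + δ * w)) := by
              rw [Real.exp_sub, mul_div_assoc', le_div_iff₀ (Real.exp_pos _)]
              linarith
            refine h4.trans ?_
            rw [mul_comm]
            exact mul_le_mul_of_nonneg_right (Real.exp_le_exp.2 (by linarith)) (hB0 x)
        _ = Real.exp (2 * δ * R) * J R * B x := by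
            rw [MeasureTheory.integral_const_mul]; ring
        _ ≤ _ := mul_le_mul_of_nonneg_right
            (mul_le_mul_of_nonneg_left (hJI R) (Real.exp_pos _).le) (hB0 x)
    · calc _ ≤ ∫ w in (Set.Ioc (-R) R)ᶜ, M * K w :=
            MeasureTheory.integral_mono (hint _ _).integrableOn (hK.const_mul _).integrableOn
              fun w => mul_le_mul_of_nonneg_right (hBM _) (hK0 w)
        _ = M * (I - J R) := by
            rw [MeasureTheory.integral_const_mul,
              MeasureTheory.setIntegral_compl measurableSet_Ioc hK]
  have hsmall : ∀ c R : ℝ, Tendsto (fun δ => Real.exp (c * δ * R)) (𝓝[>] 0) (𝓝 1) := by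
    intro c R
    have : Continuous fun δ : ℝ => Real.exp (c * δ * R) := by fun_prop
    simpa using (this.tendsto 0).mono_left nhdsWithin_le_nhds
  -- Order of choices: R first, to make the tail of K negligible, then δ with exp (±2δR) near 1, and
  -- only then x large.
  refine tendsto_order.2 ⟨fun b hb => ?_, fun b hb => ?_⟩
  · have h1 : Tendsto (fun R => 1 * I * b + M * (I - J R)) atTop (𝓝 (1 * I * b + M * (I - I))) :=
      (tendsto_const_nhds.sub hJ).const_mul M |>.const_add _
    have hlt : 1 * I * b + M * (I - I) < l * I := by
      have := mul_lt_mul_of_pos_right hb hKpos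
      linarith
    obtain ⟨R, hR, hR0⟩ := ((h1.eventually_lt_const hlt).and (eventually_gt_atTop 0)).exists
    have h2 : Tendsto (fun δ => Real.exp (2 * δ * R) * I * b + M * (I - J R)) (𝓝[>] 0)
        (𝓝 (1 * I * b + M * (I - J R))) :=
      (((hsmall 2 R).mul_const I).mul_const b).add_const _
    obtain ⟨δ, hδ, hδ0⟩ := ((h2.eventually_lt_const hR).and self_mem_nhdsWithin).exists
    have hδ0 : 0 < δ := hδ0
    have h3 := (h δ hδ0).comp (tendsto_atTop_add_const_right atTop (-(δ * R)) tendsto_id)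
    filter_upwards [h3.eventually_const_lt hδ] with x hx
    have h4 := hx.trans_le (hupp δ R x hδ0 hR0)
    exact lt_of_mul_lt_mul_left (by linarith : Real.exp (2 * δ * R) * I * b <
      Real.exp (2 * δ * R) * I * B x) (mul_pos (Real.exp_pos _) hKpos).le
  · obtain ⟨R, hR, hR0⟩ := (((hJ.const_mul (b * 1)).eventually_const_lt
      (by simpa using mul_lt_mul_of_pos_right hb hKpos : l * I < b * 1 * I)).and
      (eventually_gt_atTop 0)).exists
    have h2 : Tendsto (fun δ => b * (Real.exp (-2 * δ * R)) * J R) (𝓝[>] 0)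
        (𝓝 (b * 1 * J R)) := ((hsmall (-2) R).const_mul b).mul_const _
    obtain ⟨δ, hδ, hδ0⟩ := ((h2.eventually_const_lt hR).and self_mem_nhdsWithin).exists
    have hδ0 : 0 < δ := hδ0
    have h3 := (h δ hδ0).comp (tendsto_atTop_add_const_right atTop (δ * R) tendsto_id)
    filter_upwards [h3.eventually_lt_const hδ] with x hx
    have h4 := (hlow δ R x hδ0 hR0).trans_lt hx
    refine lt_of_mul_lt_mul_right (h4.trans_eq ?_)
      (mul_nonneg (Real.exp_pos (-(2 * δ * R))).le (hJ0 R))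
    rw [mul_assoc]
    congr 3
    ring

/-! ### Laplace transforms and the Wiener-Ikehara theorem -/

open MeasureTheory in
/-- A bounded function supported on a half-line has an absolutely convergent Laplace transform. -/
theorem integrable_exp_mul_of_bounded {D : ℝ → ℂ} {M u₀ : ℝ} (hD : Measurable D)
    (hDM : ∀ u, ‖D u‖ ≤ M) (hD0 : ∀ u < u₀, D u = 0) {s : ℂ} (hs : 0 < s.re) :
    Integrable fun u : ℝ => Complex.exp (-s * u) * D u := by
  have h1 : IntegrableOn (fun u : ℝ => Complex.exp (-s * u) * D u) (Set.Ioi (u₀ - 1)) :=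
    (integrableOn_exp_mul_complex_Ioi (a := -s) (by simpa using hs) _).mul_bdd
      (c := M) hD.aestronglyMeasurable (Eventually.of_forall hDM)
  refine (integrableOn_iff_integrable_of_support_subset fun u hu => ?_).1 h1
  by_contra hu'
  rw [Set.mem_Ioi, not_lt] at hu'
  exact hu (by simp [hD0 u (by linarith)])

open MeasureTheory FourierTransform in
/-- A bounded function supported on a half-line whose Laplace transform extends continuously to
the imaginary axis has vanishing averages at infinity against Fourier transforms of compactly
supported functions. -/
theorem tendsto_integral_mul_fourier_of_laplace {D : ℝ → ℂ} {M u₀ : ℝ} {G : ℂ → ℂ} {g : ℝ → ℂ}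
    (hD : Measurable D) (hDM : ∀ u, ‖D u‖ ≤ M) (hD0 : ∀ u < u₀, D u = 0)
    (hG : ContinuousOn G {s | 0 ≤ s.re})
    (hlap : ∀ s : ℂ, 0 < s.re → ∫ u : ℝ, Complex.exp (-s * u) * D u = G s)
    (hg : Continuous g) (hgs : HasCompactSupport g) (hgK : Integrable (𝓕 g)) :
    Tendsto (fun x => ∫ u, D u * 𝓕 g (u - x)) atTop (𝓝 0) := by
  have hgi : Integrable g := hg.integrable_of_hasCompactSupport hgs
  -- The factor 2π matches the character `𝐞`: exp (-p u) = exp (-εu) 𝐞(-vu).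
  let p : ℝ → ℝ → ℂ := fun ε v => ε + (2 * Real.pi * v : ℝ) * Complex.I
  have hpre : ∀ ε v, (p ε v).re = ε := fun ε v => by simp [p]
  have hpc : Continuous fun q : ℝ × ℝ => p q.1 q.2 := by fun_prop
  have hDint : ∀ ε : ℝ, 0 < ε → Integrable fun u : ℝ => D u * Complex.exp (-(ε : ℂ) * u) := by
    intro ε hε
    simpa only [mul_comm] using
      integrable_exp_mul_of_bounded hD hDM hD0 (s := ε) (by simpa using hε)
  have key : ∀ ε : ℝ, 0 < ε → ∀ x : ℝ, ∫ u : ℝ, D u * Complex.exp (-(ε : ℂ) * u) * 𝓕 g (u - x) =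
      ∫ v : ℝ, 𝐞 (v * x) • (g v * G (p ε v)) := by
    intro ε hε x
    have hint : Integrable (Function.uncurry fun u v : ℝ =>
        D u * Complex.exp (-(ε : ℂ) * u) * (𝐞 (-(v * (u - x))) • g v)) (volume.prod volume) := by
      have h1 := (hDint ε hε).mul_prod hgi
      have h2 : Continuous fun q : ℝ × ℝ => ((𝐞 (-(q.2 * (q.1 - x))) : Circle) : ℂ) := by
        fun_prop
      refine (h1.bdd_mul (c := 1) h2.aestronglyMeasurable
        (Eventually.of_forall fun q => (Circle.norm_coe _).le)).congr (Eventually.of_forall fun q => ?_)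
      simp only [Function.uncurry, Circle.smul_def, smul_eq_mul]
      ring
    have h1 : ∀ u : ℝ, D u * Complex.exp (-(ε : ℂ) * u) * 𝓕 g (u - x) =
        ∫ v : ℝ, D u * Complex.exp (-(ε : ℂ) * u) * (𝐞 (-(v * (u - x))) • g v) := by
      intro u
      rw [Real.fourier_real_eq, integral_const_mul]
    simp_rw [h1]
    rw [integral_integral_swap hint]
    refine integral_congr_ae (Eventually.of_forall fun v => ?_)
    simp only
    rw [← hlap _ (by rw [hpre]; exact hε), Circle.smul_def, smul_eq_mul, ← mul_assoc,
      ← integral_const_mul]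
    refine integral_congr_ae (Eventually.of_forall fun u => ?_)
    simp only [Circle.smul_def, smul_eq_mul, Real.fourierChar_apply, p]
    rw [show -(v * (u - x)) = v * x + -(v * u) by ring]
    have : -((ε : ℂ) + ((2 * Real.pi * v : ℝ) : ℂ) * Complex.I) * u =
      -(ε : ℂ) * u + ((2 * Real.pi * -(v * u) : ℝ) : ℂ) * Complex.I := by push_cast; ring
    rw [this, mul_add, Complex.ofReal_add, add_mul, Complex.exp_add, Complex.exp_add]
    ring
  -- Let ε → 0 in `key`. Domination on the left uses that D vanishes below u₀; on the right, that G
  -- ∘ p is bounded on the compact set [0,1] × supp g.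
  have hlim : ∀ x : ℝ, ∫ u : ℝ, D u * 𝓕 g (u - x) =
      ∫ v : ℝ, 𝐞 (v * x) • (g v * G (p 0 v)) := by
    intro x
    have hsub : Set.Ioc (0 : ℝ) 1 ∈ 𝓝[>] (0 : ℝ) := Ioc_mem_nhdsGT one_pos
    have hL : Tendsto (fun ε : ℝ => ∫ u : ℝ, D u * Complex.exp (-(ε : ℂ) * u) * 𝓕 g (u - x))
        (𝓝[>] 0) (𝓝 (∫ u : ℝ, D u * 𝓕 g (u - x))) := by
      refine tendsto_integral_filter_of_dominated_convergence
        (fun u => M * Real.exp |u₀| * ‖𝓕 g (u - x)‖) ?_ ?_ ?_ ?_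
      · refine Eventually.of_forall fun ε => ?_
        refine AEStronglyMeasurable.mul (hD.mul (by fun_prop)).aestronglyMeasurable
          (hgK.comp_sub_right x).aestronglyMeasurable
      · filter_upwards [hsub] with ε hε
        refine Eventually.of_forall fun u => ?_
        rw [norm_mul]
        refine mul_le_mul_of_nonneg_right ?_ (norm_nonneg _)
        have hM0 : 0 ≤ M := (norm_nonneg _).trans (hDM 0)
        rcases lt_or_ge u u₀ with hu | hu
        · rw [hD0 u hu, zero_mul, norm_zero]; positivity
        · rw [norm_mul]
          refine mul_le_mul (hDM u) ?_ (norm_nonneg _) hM0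
          rw [Complex.norm_exp]
          refine Real.exp_le_exp.2 ?_
          have h1 : -|u₀| ≤ u := (neg_abs_le u₀).trans hu
          have h2 : ε * -|u₀| ≤ ε * u := mul_le_mul_of_nonneg_left h1 hε.1.le
          have h3 : ε * |u₀| ≤ 1 * |u₀| := mul_le_mul_of_nonneg_right hε.2 (abs_nonneg _)
          simp
          linarith
      · exact (hgK.comp_sub_right x).norm.const_mul _
      · refine Eventually.of_forall fun u => ?_
        have hc : Continuous fun ε : ℝ => D u * Complex.exp (-(ε : ℂ) * u) * 𝓕 g (u - x) := by
          fun_prop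
        simpa using (hc.tendsto 0).mono_left nhdsWithin_le_nhds
    have hcomp : IsCompact (Set.Icc (0 : ℝ) 1 ×ˢ tsupport g) := isCompact_Icc.prod hgs
    have hGc : ContinuousOn (fun q : ℝ × ℝ => G (p q.1 q.2)) (Set.Ici 0 ×ˢ Set.univ) :=
      hG.comp hpc.continuousOn fun q hq => by
        change 0 ≤ (p q.1 q.2).re
        rw [hpre]
        exact hq.1
    obtain ⟨C, hC⟩ := hcomp.exists_bound_of_continuousOn
      (hGc.mono (Set.prod_mono Set.Icc_subset_Ici_self (Set.subset_univ _)))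
    have hR : Tendsto (fun ε : ℝ => ∫ v : ℝ, 𝐞 (v * x) • (g v * G (p ε v)))
        (𝓝[>] 0) (𝓝 (∫ v : ℝ, 𝐞 (v * x) • (g v * G (p 0 v)))) := by
      refine tendsto_integral_filter_of_dominated_convergence (fun v => ‖g v‖ * C) ?_ ?_ ?_ ?_
      · filter_upwards [hsub] with ε hε
        have h1 : Continuous fun v => G (p ε v) :=
          continuousOn_univ.1 (hGc.comp (f := fun v : ℝ => (ε, v)) (by fun_prop)
            fun v _ => ⟨hε.1.le, Set.mem_univ _⟩)
        have h2 : Continuous fun v : ℝ => 𝐞 (v * x) := by fun_prop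
        exact (h2.smul (hg.mul h1)).aestronglyMeasurable
      · filter_upwards [hsub] with ε hε
        refine Eventually.of_forall fun v => ?_
        rw [Circle.norm_smul, norm_mul]
        by_cases hv : v ∈ tsupport g
        · exact mul_le_mul_of_nonneg_left (hC (ε, v) ⟨⟨hε.1.le, hε.2⟩, hv⟩) (norm_nonneg _)
        · simp [image_eq_zero_of_notMem_tsupport hv]
      · exact hgi.norm.mul_const _
      · refine Eventually.of_forall fun v => ?_
        have h1 : ContinuousWithinAt (fun ε : ℝ => G (p ε v)) (Set.Ici 0) 0 :=
          (hGc (0, v) ⟨Set.self_mem_Ici, Set.mem_univ _⟩).comp (f := fun ε : ℝ => (ε, v))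
            (by fun_prop) fun ε hε => ⟨hε, Set.mem_univ _⟩
        exact ((h1.mono Set.Ioi_subset_Ici_self).tendsto.const_mul (g v)).const_smul (𝐞 (v * x))
    refine tendsto_nhds_unique hL (hR.congr' ?_)
    filter_upwards [self_mem_nhdsWithin] with ε hε
    exact (key ε hε x).symm
  have hRL := (Real.zero_at_infty_fourier fun v => g v * G (p 0 v)).comp
    (tendsto_neg_atTop_atBot.mono_right atBot_le_cocompact)
  refine hRL.congr fun x => ?_
  rw [hlim x, Function.comp_apply, Real.fourier_real_eq]
  simp only [mul_neg, neg_neg]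

open MeasureTheory FourierTransform in
/-- **Wiener-Ikehara theorem** for bounded functions. -/
theorem tendsto_of_laplace_simple_pole {B : ℝ → ℝ} {M u₀ : ℝ} {L : ℂ} {G : ℂ → ℂ}
    (hB0 : ∀ u, 0 ≤ B u) (hBM : ∀ u, B u ≤ M) (hmono : Monotone fun u => Real.exp u * B u)
    (hBsupp : ∀ u < u₀, B u = 0) (hG : ContinuousOn G {s | 0 ≤ s.re})
    (hlap : ∀ s : ℂ, 0 < s.re → ∫ u : ℝ, Complex.exp (-s * u) * B u = L / s + G s) :
    L.im = 0 ∧ Tendsto B atTop (𝓝 L.re) := by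
  obtain ⟨g, K, hg, hgs, hgK, hK0, hK, hKpos⟩ := exists_hasCompactSupport_fourier_nonneg
  have hBmeas := measurable_of_monotone_exp_mul hmono
  have hint : ∀ s : ℂ, 0 < s.re → Integrable fun u : ℝ => Complex.exp (-s * u) * B u := fun s hs =>
    integrable_exp_mul_of_bounded (M := M) (u₀ := u₀) (Complex.measurable_ofReal.comp hBmeas)
      (fun u => by
        rw [Function.comp_apply, Complex.norm_real, Real.norm_of_nonneg (hB0 u)]
        exact hBM u)
      (fun u hu => by simp [hBsupp u hu]) hs
  -- The subtracted step has Laplace transform L/s, exactly the polar part.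
  let D : ℝ → ℂ := fun u => B u - (Set.Ioi (0 : ℝ)).indicator (fun _ => L) u
  have hDmeas : Measurable D := (Complex.measurable_ofReal.comp hBmeas).sub
    (measurable_const.indicator measurableSet_Ioi)
  have hDM : ∀ u, ‖D u‖ ≤ M + ‖L‖ := fun u => by
    refine (norm_sub_le _ _).trans (add_le_add ?_ (norm_indicator_le_norm_self _ _))
    rw [Complex.norm_real, Real.norm_of_nonneg (hB0 u)]
    exact hBM u
  have hD0 : ∀ u < min u₀ 0, D u = 0 := fun u hu => by
    have h1 : u ∉ Set.Ioi (0 : ℝ) := fun h => by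
      have := hu.trans_le (min_le_right _ _)
      exact absurd h (not_lt.2 this.le)
    simp [D, hBsupp u (hu.trans_le (min_le_left _ _)), Set.indicator_of_notMem h1]
  have hDlap : ∀ s : ℂ, 0 < s.re → ∫ u : ℝ, Complex.exp (-s * u) * D u = G s := by
    intro s hs
    have hs' : (-s).re < 0 := by simpa using hs
    have h1 : ∀ u : ℝ, Complex.exp (-s * u) * (Set.Ioi (0 : ℝ)).indicator (fun _ => L) u =
        (Set.Ioi (0 : ℝ)).indicator (fun u : ℝ => Complex.exp (-s * u) * L) u := by
      intro u
      by_cases hu : u ∈ Set.Ioi (0 : ℝ) <;> simp [hu]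
    simp only [D, mul_sub, h1]
    rw [integral_sub (hint s hs), hlap s hs, integral_indicator measurableSet_Ioi,
      integral_mul_const, integral_exp_mul_complex_Ioi hs']
    · have : s ≠ 0 := by rintro rfl; simp at hs
      simp
      field_simp
      ring
    · rw [integrable_indicator_iff measurableSet_Ioi]
      exact (integrableOn_exp_mul_complex_Ioi hs' 0).mul_const L
  have havg : ∀ δ > 0, Tendsto (fun x => ((∫ w, B (x + δ * w) * K w : ℝ) : ℂ)) atTop
      (𝓝 (L * (∫ w, K w : ℝ))) := by
    intro δ hδ
    -- Dilating g stays within compactly supported functions and rescales the kernel to K(w/δ)/δ.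
    let h : ℝ → ℂ := fun v => g (δ * v)
    have hh : Continuous h := hg.comp (by fun_prop)
    have hhs : HasCompactSupport h :=
      hgs.comp_homeomorph (Homeomorph.mulLeft₀ δ hδ.ne')
    have hF : ∀ w, 𝓕 h w = (δ⁻¹ : ℝ) * K (w / δ) := by
      intro w
      rw [← hgK, Real.fourier_real_eq, Real.fourier_real_eq]
      have := Measure.integral_comp_mul_left
        (fun v => 𝐞 (-(v * (w / δ))) • g v) δ
      rw [abs_of_pos (inv_pos.2 hδ)] at this
      rw [← Complex.real_smul, ← this]
      refine integral_congr_ae (Eventually.of_forall fun v => ?_)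
      simp only [h]
      congr 3
      field_simp
    have hFi : Integrable (𝓕 h) := by
      have h1 : Integrable fun w => ((δ⁻¹ : ℝ) : ℂ) * (K (w / δ) : ℂ) :=
        ((hK.comp_div hδ.ne').ofReal).const_mul _
      exact h1.congr (Eventually.of_forall fun w => (hF w).symm)
    have h1 := tendsto_integral_mul_fourier_of_laplace hDmeas hDM hD0 hG hDlap hh hhs hFi
    have h2 : ∀ x, ∫ u, D u * 𝓕 h (u - x) = ∫ w, D (x + δ * w) * K w := by
      intro x
      have e1 := Measure.integral_comp_mul_left (fun u => D (x + u) * 𝓕 h u) δ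
      have e2 := integral_add_left_eq_self (μ := volume) (fun u => D u * 𝓕 h (u - x)) x
      simp only [add_sub_cancel_left] at e2
      rw [← e2]
      rw [abs_of_pos (inv_pos.2 hδ)] at e1
      have e3 : ∫ u, D (x + u) * 𝓕 h u = δ • ∫ w, D (x + δ * w) * 𝓕 h (δ * w) := by
        rw [e1, smul_smul, mul_inv_cancel₀ hδ.ne', one_smul]
      rw [e3, ← integral_smul]
      refine integral_congr_ae (Eventually.of_forall fun w => ?_)
      have hδ' : (δ : ℂ) ≠ 0 := by exact_mod_cast hδ.ne'
      simp only [hF, Complex.real_smul, mul_div_cancel_left₀ w hδ.ne']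
      push_cast
      field_simp
    simp_rw [h2] at h1
    have h3 : Tendsto (fun x => ∫ w, (Set.Ioi (0 : ℝ)).indicator (fun _ => L) (x + δ * w) * K w)
        atTop (𝓝 (∫ w, L * (K w : ℂ))) := by
      refine tendsto_integral_filter_of_dominated_convergence (fun w => ‖L‖ * K w) ?_ ?_ ?_ ?_
      · refine Eventually.of_forall fun x => ?_
        have : Measurable fun w : ℝ => (Set.Ioi (0 : ℝ)).indicator (fun _ => L) (x + δ * w) :=
          (measurable_const.indicator measurableSet_Ioi).comp (by fun_prop)
        exact this.aestronglyMeasurable.mul hK.ofReal.aestronglyMeasurable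
      · refine Eventually.of_forall fun x => Eventually.of_forall fun w => ?_
        rw [norm_mul, Complex.norm_real, Real.norm_of_nonneg (hK0 w)]
        exact mul_le_mul_of_nonneg_right (norm_indicator_le_norm_self _ _) (hK0 w)
      · exact hK.const_mul _
      · refine Eventually.of_forall fun w => ?_
        refine tendsto_const_nhds.congr' ?_
        filter_upwards [eventually_gt_atTop (-(δ * w))] with x hx
        rw [Set.indicator_of_mem (show x + δ * w ∈ Set.Ioi (0 : ℝ) by
          rw [Set.mem_Ioi]; linarith)]
    have h4 := h1.add h3
    rw [zero_add, integral_const_mul, integral_complex_ofReal] at h4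
    refine h4.congr fun x => ?_
    have hi : ∀ f : ℝ → ℂ, Measurable f → (∃ C, ∀ u, ‖f u‖ ≤ C) →
        Integrable fun w => f (x + δ * w) * (K w : ℂ) := fun f hf ⟨C, hC⟩ =>
      hK.ofReal.bdd_mul (c := C) (hf.comp (by fun_prop)).aestronglyMeasurable
        (Eventually.of_forall fun w => hC _)
    rw [← integral_add (hi D hDmeas ⟨_, hDM⟩) (hi _ (measurable_const.indicator
      measurableSet_Ioi) ⟨‖L‖, fun u => norm_indicator_le_norm_self _ _⟩),
      ← integral_complex_ofReal]
    refine integral_congr_ae (Eventually.of_forall fun w => ?_)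
    simp only [D]
    push_cast
    ring
  constructor
  -- The averages are real, hence so is their limit L ∫ K, and ∫ K ≠ 0.
  · have h1 := (Complex.continuous_im.tendsto _).comp (havg 1 one_pos)
    have h2 : (0 : ℝ) = (L * (∫ w, K w : ℝ)).im := by
      refine tendsto_nhds_unique (tendsto_const_nhds.congr fun x => ?_) h1
      simp
    rw [Complex.im_mul_ofReal] at h2
    exact (mul_eq_zero.1 h2.symm).resolve_right hKpos.ne'
  · refine tendsto_of_tendsto_average hB0 hBM hmono hK0 hK hKpos fun δ hδ => ?_
    have h1 := (Complex.continuous_re.tendsto _).comp (havg δ hδ)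
    rw [Complex.re_mul_ofReal] at h1
    exact h1.congr fun x => by simp

/-! ### The counting function of a decreasing sequence -/

/-- The number of terms of the sequence `b` that are at least `exp (-u)`. -/
noncomputable def countAbove (b : ℕ → ℝ) (u : ℝ) : ℝ := Set.ncard {n | Real.exp (-u) ≤ b n}

section Counting

variable {b : ℕ → ℝ} {C : ℝ}

/-- Combining exp (-u) ≤ b n with the bound on b n gives n + 1 ≤ C exp u. Finiteness, boundedness of
exp (-u) N(u) and vanishing of N far to the left all come from this. -/
theorem setOf_exp_neg_le_subset (hbC : ∀ n : ℕ, b n ≤ C / (n + 1)) (u : ℝ) :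
    {n | Real.exp (-u) ≤ b n} ⊆ Finset.range ⌊C * Real.exp u⌋₊ := by
  intro n hn
  have h1 : Real.exp (-u) ≤ C / (n + 1) := le_trans hn (hbC n)
  rw [Finset.mem_coe, Finset.mem_range, Nat.lt_iff_add_one_le]
  refine Nat.le_floor ?_
  rw [Real.exp_neg, inv_le_iff_one_le_mul₀ (Real.exp_pos u), div_mul_eq_mul_div,
    one_le_div (by positivity)] at h1
  exact_mod_cast h1

theorem finite_setOf_exp_neg_le (hbC : ∀ n : ℕ, b n ≤ C / (n + 1)) (u : ℝ) :
    {n | Real.exp (-u) ≤ b n}.Finite :=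
  (Finset.finite_toSet _).subset (setOf_exp_neg_le_subset hbC u)

theorem countAbove_mono (hbC : ∀ n : ℕ, b n ≤ C / (n + 1)) : Monotone (countAbove b) := by
  intro u v huv
  refine Nat.cast_le.2 (Set.ncard_le_ncard (fun n hn => ?_) (finite_setOf_exp_neg_le hbC v))
  exact (Real.exp_le_exp.2 (neg_le_neg huv)).trans hn

theorem countAbove_le (hC : 0 ≤ C) (hbC : ∀ n : ℕ, b n ≤ C / (n + 1)) (u : ℝ) :
    countAbove b u ≤ C * Real.exp u := by
  have h := Set.ncard_le_ncard (setOf_exp_neg_le_subset hbC u) (Finset.finite_toSet _)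
  rw [Set.ncard_coe_finset, Finset.card_range] at h
  exact (Nat.cast_le.2 h).trans (Nat.floor_le (mul_nonneg hC (Real.exp_pos u).le))

theorem countAbove_eq_zero (hC : 0 < C) (hbC : ∀ n : ℕ, b n ≤ C / (n + 1)) {u : ℝ}
    (hu : u < -Real.log C) : countAbove b u = 0 := by
  have h1 : C * Real.exp u < 1 := by
    have := Real.exp_lt_exp.2 hu
    rw [Real.exp_neg, Real.exp_log hC, lt_inv_comm₀ (Real.exp_pos u) hC] at this
    calc C * Real.exp u < (Real.exp u)⁻¹ * Real.exp u :=
          mul_lt_mul_of_pos_right this (Real.exp_pos u)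
      _ = 1 := inv_mul_cancel₀ (Real.exp_pos u).ne'
  have h2 := setOf_exp_neg_le_subset hbC u
  rw [Nat.floor_eq_zero.2 h1, Finset.range_zero, Finset.coe_empty, Set.subset_empty_iff] at h2
  rw [countAbove, h2, Set.ncard_empty, Nat.cast_zero]

theorem succ_le_countAbove (hb : Antitone b) (hbC : ∀ n : ℕ, b n ≤ C / (n + 1)) {n : ℕ} {u : ℝ}
    (h : Real.exp (-u) ≤ b n) : (n : ℝ) + 1 ≤ countAbove b u := by
  have h1 : ((Finset.range (n + 1) : Finset ℕ) : Set ℕ) ⊆ {n | Real.exp (-u) ≤ b n} := by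
    intro m hm
    rw [Finset.mem_coe, Finset.mem_range, Nat.lt_succ_iff] at hm
    exact h.trans (hb hm)
  have h2 := Set.ncard_le_ncard h1 (finite_setOf_exp_neg_le hbC u)
  rw [Set.ncard_coe_finset, Finset.card_range] at h2
  rw [countAbove]
  exact_mod_cast h2

theorem countAbove_le_natCast (hb : Antitone b) {n : ℕ} {u : ℝ} (h : b n < Real.exp (-u)) :
    countAbove b u ≤ n := by
  have h1 : {n | Real.exp (-u) ≤ b n} ⊆ ((Finset.range n : Finset ℕ) : Set ℕ) := by
    intro m hm
    rw [Finset.mem_coe, Finset.mem_range]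
    by_contra hmn
    exact absurd (le_trans hm (hb (not_lt.1 hmn))) (not_le.2 h)
  have h2 := Set.ncard_le_ncard h1 (Finset.finite_toSet _)
  rw [Set.ncard_coe_finset, Finset.card_range] at h2
  exact Nat.cast_le.2 h2

theorem setOf_exp_neg_le_eq_Ici {c : ℝ} (hc : 0 < c) :
    {u : ℝ | Real.exp (-u) ≤ c} = Set.Ici (-Real.log c) := by
  ext u
  change Real.exp (-u) ≤ c ↔ -Real.log c ≤ u
  rw [← Real.le_log_iff_exp_le hc, neg_le]

theorem setOf_exp_neg_le_zero : {u : ℝ | Real.exp (-u) ≤ 0} = ∅ :=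
  Set.eq_empty_of_forall_notMem fun _ hu => absurd hu (not_le.2 (Real.exp_pos _))

theorem summable_rpow_of_le_div (hb0 : ∀ n, 0 ≤ b n) (hC : 0 ≤ C)
    (hbC : ∀ n : ℕ, b n ≤ C / (n + 1)) {σ : ℝ} (hσ : 1 < σ) : Summable fun n => b n ^ σ := by
  have h1 : Summable fun n : ℕ => C ^ σ * (1 / ((n + 1 : ℕ) : ℝ) ^ σ) :=
    ((summable_nat_add_iff 1).2 (Real.summable_one_div_nat_rpow.2 hσ)).mul_left _
  refine Summable.of_nonneg_of_le (fun n => Real.rpow_nonneg (hb0 n) _) (fun n => ?_) h1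
  refine (Real.rpow_le_rpow (hb0 n) (hbC n) (by linarith)).trans_eq ?_
  rw [Real.div_rpow hC (by positivity)]
  push_cast
  ring

open MeasureTheory in
/-- The Laplace transform of the counting function is the zeta function divided by `s`. -/
theorem integral_exp_mul_countAbove (hb0 : ∀ n, 0 ≤ b n) (hC : 0 ≤ C)
    (hbC : ∀ n : ℕ, b n ≤ C / (n + 1)) {s : ℂ} (hs : 1 < s.re) :
    ∫ u : ℝ, Complex.exp (-s * u) * countAbove b u = (∑' n, (b n : ℂ) ^ s) / s := by
  have hs0 : 0 < s.re := by linarith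
  have hsne : s ≠ 0 := by rintro rfl; simp at hs0
  have hsneg : (-s).re < 0 := by simpa using hs0
  -- Summed over n these give exp (-su) N(u), while each integrates to (b n)^s / s, including b n =
  -- 0 since s ≠ 0.
  let f : ℕ → ℝ → ℂ := fun n =>
    {u : ℝ | Real.exp (-u) ≤ b n}.indicator fun u : ℝ => Complex.exp (-s * u)
  have hmeas : ∀ n, MeasurableSet {u : ℝ | Real.exp (-u) ≤ b n} := fun n =>
    measurableSet_le (by fun_prop) measurable_const
  have hfint : ∀ n, Integrable (f n) := by
    intro n
    rw [integrable_indicator_iff (hmeas n)]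
    rcases (hb0 n).eq_or_lt with h | h
    · rw [← h, setOf_exp_neg_le_zero]; exact integrableOn_empty
    · rw [setOf_exp_neg_le_eq_Ici h, integrableOn_Ici_iff_integrableOn_Ioi]
      exact integrableOn_exp_mul_complex_Ioi hsneg _
  have hfval : ∀ n, ∫ u, f n u = (b n : ℂ) ^ s / s := by
    intro n
    rw [integral_indicator (hmeas n)]
    rcases (hb0 n).eq_or_lt with h | h
    · rw [← h, setOf_exp_neg_le_zero]
      simp [Complex.zero_cpow hsne]
    · rw [setOf_exp_neg_le_eq_Ici h, integral_Ici_eq_integral_Ioi,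
        integral_exp_mul_complex_Ioi hsneg, neg_div_neg_eq,
        Complex.cpow_def_of_ne_zero (by exact_mod_cast h.ne'), ← Complex.ofReal_log h.le]
      congr 2
      push_cast
      ring
  have hfnorm : ∀ n, ∫ u, ‖f n u‖ = b n ^ s.re / s.re := by
    intro n
    simp only [f, norm_indicator_eq_indicator_norm, Complex.norm_exp]
    rw [integral_indicator (hmeas n)]
    have hre : ∀ u : ℝ, (-s * u).re = -s.re * u := fun u => by simp
    simp only [hre]
    rcases (hb0 n).eq_or_lt with h | h
    · rw [← h, setOf_exp_neg_le_zero]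
      simp [Real.zero_rpow hs0.ne']
    · rw [setOf_exp_neg_le_eq_Ici h, integral_Ici_eq_integral_Ioi,
        integral_exp_mul_Ioi (by linarith), neg_div_neg_eq, Real.rpow_def_of_pos h]
      congr 2
      ring
  have hsum := hasSum_integral_of_summable_integral_norm hfint (by
    simp only [hfnorm]
    exact (summable_rpow_of_le_div hb0 hC hbC hs).div_const _)
  simp only [hfval] at hsum
  rw [← tsum_div_const, hsum.tsum_eq]
  refine integral_congr_ae (Eventually.of_forall fun u => ?_)
  have hfin := finite_setOf_exp_neg_le hbC u
  have h1 : ∀ n ∉ hfin.toFinset, f n u = 0 := fun n hn => by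
    rw [Set.Finite.mem_toFinset] at hn
    exact Set.indicator_of_notMem (s := {u : ℝ | Real.exp (-u) ≤ b n}) hn _
  have h2 : ∀ n ∈ hfin.toFinset, f n u = Complex.exp (-s * u) := fun n hn => by
    rw [Set.Finite.mem_toFinset] at hn
    exact Set.indicator_of_mem (s := {u : ℝ | Real.exp (-u) ≤ b n}) hn _
  simp only
  rw [tsum_eq_sum h1, Finset.sum_congr rfl h2, Finset.sum_const, countAbove,
    Set.ncard_eq_toFinset_card _ hfin, nsmul_eq_mul, mul_comm, Complex.ofReal_natCast]

/-- Inversion of the asymptotics of the counting function. -/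
theorem tendsto_mul_of_tendsto_countAbove (hb : Antitone b) (hb0 : ∀ n, 0 ≤ b n)
    (hbC : ∀ n : ℕ, b n ≤ C / (n + 1)) {l : ℝ}
    (h : Tendsto (fun u => Real.exp (-u) * countAbove b u) atTop (𝓝 l)) :
    Tendsto (fun n : ℕ => b n * (n + 1)) atTop (𝓝 l) := by
  have hl : 0 ≤ l := ge_of_tendsto' h fun u =>
    mul_nonneg (Real.exp_pos _).le (Nat.cast_nonneg _)
  have hlim : Tendsto b atTop (𝓝 0) := by
    refine squeeze_zero hb0 hbC ?_
    simpa [div_eq_mul_inv] using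
      (tendsto_one_div_add_atTop_nhds_zero_nat (𝕜 := ℝ)).const_mul C
  have ht : Tendsto (fun t : ℝ => t * countAbove b (-Real.log t)) (𝓝[>] 0) (𝓝 l) := by
    refine (h.comp (tendsto_neg_atBot_atTop.comp Real.tendsto_log_nhdsGT_zero)).congr' ?_
    filter_upwards [self_mem_nhdsWithin] with t ht
    simp only [Function.comp_apply, neg_neg]
    rw [Real.exp_log ht]
  refine tendsto_order.2 ⟨fun a ha => ?_, fun a ha => ?_⟩
  · obtain ⟨a', haa', ha'⟩ := exists_between ha
    obtain ⟨t₀, ht₀, hsub⟩ := mem_nhdsGT_iff_exists_Ioo_subset.1 (ht.eventually_const_lt ha')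
    filter_upwards [hlim.eventually_lt_const ht₀] with n hn
    -- Here b n may vanish or be repeated, so the count is taken at t > b n, where it is at most n,
    -- and then t decreases to b n. The limit keeps only ≤, hence the intermediate a'.
    have h1 : ∀ t ∈ Set.Ioo (b n) t₀, a' ≤ t * n := fun t ht' => by
      have ht0 : 0 < t := (hb0 n).trans_lt ht'.1
      have h2 : a' < t * countAbove b (-Real.log t) := hsub ⟨ht0, ht'.2⟩
      refine h2.le.trans (mul_le_mul_of_nonneg_left ?_ ht0.le)
      exact countAbove_le_natCast hb (by rw [neg_neg, Real.exp_log ht0]; exact ht'.1)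
    have h2 : Tendsto (fun t : ℝ => t * n) (𝓝[>] (b n)) (𝓝 (b n * n)) :=
      ((continuous_id.mul continuous_const).tendsto (b n)).mono_left nhdsWithin_le_nhds
    have h3 : a' ≤ b n * n := ge_of_tendsto h2 <| by
      filter_upwards [Ioo_mem_nhdsGT hn] with t ht' using h1 t ht'
    have := hb0 n
    linarith
  · obtain ⟨t₀, ht₀, hsub⟩ := mem_nhdsGT_iff_exists_Ioo_subset.1 (ht.eventually_lt_const ha)
    filter_upwards [hlim.eventually_lt_const ht₀] with n hn
    rcases (hb0 n).eq_or_lt with h0 | h0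
    · rw [← h0, zero_mul]; exact hl.trans_lt ha
    · have h2 : b n * countAbove b (-Real.log (b n)) < a := hsub ⟨h0, hn⟩
      refine lt_of_le_of_lt (mul_le_mul_of_nonneg_left ?_ h0.le) h2
      exact succ_le_countAbove hb hbC (by rw [neg_neg, Real.exp_log h0])

/-- **Wiener-Ikehara theorem** for the zeta function of a decreasing sequence. -/
theorem tendsto_mul_of_extendsUpToSimplePole (hb : Antitone b) (hb0 : ∀ n, 0 ≤ b n)
    (hC : 0 < C) (hbC : ∀ n : ℕ, b n ≤ C / (n + 1)) {L : ℂ}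
    (hL : ExtendsUpToSimplePole (fun z => ∑' n, (b n : ℂ) ^ z) L) :
    Tendsto (fun n : ℕ => ((b n * (n + 1) : ℝ) : ℂ)) atTop (𝓝 L) := by
  obtain ⟨F, hF, hFc, c, hc⟩ := hL
  let E : ℂ → ℂ := Function.update (fun z => F z - L / (z - 1)) 1 c
  have hE : ContinuousOn E {z | 1 ≤ z.re} := by
    refine continuousOn_update_iff.2 ⟨hFc.sub ?_, fun _ => hc⟩
    exact continuousOn_const.div (by fun_prop) fun z hz => sub_ne_zero.2 hz.2
  -- From L/(s(1+s)) = L/s - L/(1+s): dividing L/s + E(1+s) by 1+s leaves L/s plus this.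
  let G : ℂ → ℂ := fun s => (E (1 + s) - L) / (1 + s)
  have hG : ContinuousOn G {s | 0 ≤ s.re} := by
    have h1 : ContinuousOn (fun s => E (1 + s)) {s | 0 ≤ s.re} :=
      hE.comp (by fun_prop) fun s (hs : 0 ≤ s.re) => by
        change 1 ≤ (1 + s).re
        simpa using hs
    refine (h1.sub continuousOn_const).div (by fun_prop) fun s (hs : 0 ≤ s.re) h0 => ?_
    have := congrArg Complex.re h0
    simp at this
    linarith
  have hWI := tendsto_of_laplace_simple_pole
    (B := fun u => Real.exp (-u) * countAbove b u) (M := C) (u₀ := -Real.log C) (L := L) (G := G)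
    (fun u => mul_nonneg (Real.exp_pos _).le (Nat.cast_nonneg _))
    (fun u => by
      rw [Real.exp_neg, inv_mul_le_iff₀ (Real.exp_pos u), mul_comm]
      exact countAbove_le hC.le hbC u)
    (by
      have : (fun u => Real.exp u * (Real.exp (-u) * countAbove b u)) = countAbove b := by
        funext u
        rw [← mul_assoc, ← Real.exp_add]
        simp
      rw [this]
      exact countAbove_mono hbC)
    (fun u hu => by rw [countAbove_eq_zero hC hbC hu, mul_zero]) hG
    (fun s hs => by
      have hs1 : 1 < (1 + s).re := by simpa using hs
      have hs0 : s ≠ 0 := by rintro rfl; simp at hs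
      have hs10 : 1 + s ≠ 0 := fun h => by rw [h] at hs1; simp at hs1; linarith
      have h1 := integral_exp_mul_countAbove hb0 hC.le hbC hs1
      have h2 : E (1 + s) = (∑' n, (b n : ℂ) ^ (1 + s)) - L / s := by
        simp only [E]
        rw [Function.update_of_ne (by simpa using hs0), hF _ hs1, add_sub_cancel_left]
      have h3 : L / s + G s = (∑' n, (b n : ℂ) ^ (1 + s)) / (1 + s) := by
        simp only [G, h2]
        field_simp
        ring
      rw [h3, ← h1]
      congr 1
      funext u
      push_cast
      rw [← mul_assoc, ← Complex.exp_add]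
      congr 2
      ring)
  have hLre : L = (L.re : ℂ) := Complex.ext rfl (by simpa using hWI.1)
  rw [hLre]
  exact (Complex.continuous_ofReal.tendsto _).comp
    (tendsto_mul_of_tendsto_countAbove hb hb0 hbC hWI.2)

end Counting

/-! ### The characteristic sequence -/

section CharSeq

variable {H : Type*} [NormedAddCommGroup H] [InnerProductSpace ℂ H] [CompleteSpace H]

theorem charSeq_nonneg (x : H →L[ℂ] H) (n : ℕ) : 0 ≤ charSeq x n :=
  Real.sInf_nonneg fun _ ht => ht.1

theorem spectralSubspaceAbove_eq_bot (x : H →L[ℂ] H) :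
    spectralSubspaceAbove x ‖(CFC.abs x : H →L[ℂ] H)‖ = ⊥ := by
  refine iSup₂_eq_bot.2 fun s hs => (Submodule.eq_bot_iff _).2 fun v hv => ?_
  have h1 : (CFC.abs x : H →L[ℂ] H) v = (s : ℂ) • v := Module.End.mem_eigenspace_iff.1 hv
  have h2 := (CFC.abs x : H →L[ℂ] H).le_opNorm v
  rw [h1, norm_smul, Complex.norm_real, Real.norm_of_nonneg ((norm_nonneg _).trans hs.le)] at h2
  by_contra hv0
  exact absurd (le_of_mul_le_mul_right h2 (norm_pos_iff.2 hv0)) (not_le.2 hs)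

/-- The sets under the infimum grow with n. The shift matters: at index 0 the set is empty and
`sInf` returns 0. From index 1 on, the norm of |x| is a member because no eigenvalue exceeds it. -/
theorem antitone_charSeq_succ (x : H →L[ℂ] H) : Antitone fun n => charSeq x (n + 1) := by
  intro m n hmn
  refine csInf_le_csInf ⟨0, fun t ht => ht.1⟩ ⟨‖(CFC.abs x : H →L[ℂ] H)‖, norm_nonneg _, ?_⟩
    fun t ht => ⟨ht.1, ht.2.trans_le ?_⟩
  · rw [spectralSubspaceAbove_eq_bot, rank_bot]
    exact_mod_cast Nat.succ_pos m
  · exact_mod_cast Nat.succ_le_succ hmn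

end CharSeq

theorem mainTheorem5 {H : Type*} [NormedAddCommGroup H] [InnerProductSpace ℂ H] [CompleteSpace H]
    (x : H →L[ℂ] H) (hx : IsCompactOperator x)
    (hO : (fun n : ℕ => charSeq x n) =O[atTop] (fun n : ℕ => 1 / (n : ℝ)))
    (L : ℂ) (hL : ExtendsUpToSimplePole (zetaOp x) L) :
    Tendsto (fun n : ℕ => (charSeq x n : ℂ) / (1 / (n : ℂ))) atTop (𝓝 L) := by
  -- On ℕ the eventual bound becomes one for every n with 1/n ≠ 0, that is, n ≥ 1.
  obtain ⟨C, hC, hCb⟩ := bound_of_isBigO_nat_atTop hO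
  have hbC : ∀ n : ℕ, charSeq x (n + 1) ≤ C / (n + 1) := fun n => by
    have h1 := hCb (x := n + 1) (by positivity)
    rw [Real.norm_of_nonneg (charSeq_nonneg x _), Real.norm_of_nonneg (by positivity),
      mul_one_div] at h1
    exact_mod_cast h1
  have h := tendsto_mul_of_extendsUpToSimplePole (antitone_charSeq_succ x)
    (fun n => charSeq_nonneg x _) hC hbC hL
  refine (tendsto_add_atTop_iff_nat 1).1 (h.congr fun n => ?_)
  rw [div_div_eq_mul_div, div_one]
  push_cast
  rfl
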